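/- **Setting.** Let $n\ge 3$ and let $\mathcal N=\{1,\dots,n\}$ index nodes at pairwise distinct positions $x_1,\dots,x_n\in\mathbb R^3$, with transmit powers $q_i>0$ and integer shape parameters $m_i\ge 1$. Let $\lambda>0$ (wavelength), $r_0=\lambda/(4\pi)$, $\alpha_{\mathrm{PL}}\ge 2$ and $\mu_{ij}=\frac1{q_i}\left(\|x_i-x_j\|/r_0\right)^{\alpha_{\mathrm{PL}}}$ for $i\neq j$. Let $N>0$ (noise), $\theta\ge 1$ (threshold), and let $m\ge1$ be the number of slots. The random variables $S_1,\dots,S_n$ (slot choices) are independent and uniform on $\{1,\dots,m\}$. The received powers $P_{ij}$, $i\ne j$, are mutually independent, jointly independent of $(S_1,\dots,S_n)$, and Gamma distributed (Nakagami fading) with density $$f_{ij}(x)=\mathbf 1(x\ge 0)\,\frac{m_i^{m_i}\mu_{ij}^{m_i}}{\Gamma(m_i)}x^{m_i-1}e^{-m_i x\mu_{ij}} .$$ For $i\neq j$ and a slot $k$ put $P_{ij}^k=\delta_{S_ik}P_{ij}$, $I_{ij}^k=\sum_{l\ne i,j}P_{lj}^k$, $X_{ij}^k=\mathbf 1\left(\frac{P_{ij}^k}{N+I_{ij}^k}\ge\theta\right)$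 and $X_{ij}=\sum_{k=1}^m X_{ij}^k$ (full-duplex success of the link from $i$ to $j$). For $x\ne y$, $J\subseteq\mathcal N\setminus\{x,y\}$ and $\xi=[\xi_\nu]_{\nu\in J}\in\mathbb R^J$ let $$\gamma_{xy}^J(\xi)=e^{-\theta m_x\mu_{xy}N}\sum_{s=0}^{m_x-1}(\theta m_x\mu_{xy}N)^s\sum_{t=0}^{s}\frac{(q_x/N)^t}{(s-t)!}\sum_{\substack{\ell\in\mathbb Z_{\ge0}^J\\ \sum_{\nu\in J}\ell_\nu=t}}\ \prod_{\nu\in J}\left[(1-\xi_\nu)\delta_{0\ell_\nu}+\binom{\ell_\nu+m_\nu-1}{\ell_\nu}\frac{\xi_\nu\left(\frac1{m_\nu q_x\mu_{\nu y}}\right)^{\ell_\nu}}{\left(\theta\frac{m_x}{m_\nu}\frac{\mu_{xy}}{\mu_{\nu y}}+1\right)^{m_\nu+\ell_\nu}}\right].$$ For $x\neq y$, a node $z$ and $c\in\{0,1\}^{\mathcal N\setminus\{x,z\}}$ let $$\alpha_{xyz}(c)=\Pr\left(\frac{P_{xy}}{N+\sum_{\nu\ne x,y,z}c_\nu P_{\nu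 y}+(1-\delta_{xz})P_{zy}}\ge\theta\right)\qquad(P_{yy}:=0),$$ and for $z\ne x$, $d\in\{1,2\}$, $c\in\{0,1,2\}^{\mathcal N\setminus\{x,z\}}$ let $$\beta^{(d)}_{xyz}(c)=\Pr\left(\frac{P_{xy}}{N+\sum_{\nu\ne x,y,z}\delta_{c_\nu d}P_{\nu y}}\ge\theta\right).$$ For $i\ne j$, $k\ne l$, $(i,j)\ne(k,l)$ put $J=\mathcal N\setminus\{i,k\}$ and $$\Phi_{ijkl}=\sum_{c\in\{0,1\}^J}\ \prod_{\nu\in J}(m-1)^{1-c_\nu}\cdot\alpha_{ijk}(c)\,\alpha_{kli}(c),$$ and, for $i\ne k$, $$\Psi_{ijkl}=\sum_{c\in\{0,1,2\}^J}\ \prod_{\nu\in J}(m-2)^{\delta_{c_\nu0}}\cdot\beta^{(1)}_{ijk}(c)\,\beta^{(2)}_{kli}(c),$$ where $0^0=1$. **Corollary (Nakagami fading, full-duplex case).** 1. For $i\neq j$, $\ \mathbb E[X_{ij}]=\gamma_{ij}^{\mathcal N\setminus\{i,j\}}\left(\tfrac1m,\dots,\tfrac1m\right)$. 2. The state coefficients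 are: - for $x\ne y$: $\alpha_{xyx}(c)=\gamma_{xy}^{\mathcal N\setminus\{x,y\}}([c_\nu]_{\nu\ne x,y})$; - for $x\neq y$, $x\ne z$: $\alpha_{xyz}(c)=\gamma_{xy}^{\mathcal N\setminus\{x,y\}}(\xi)$ with $\xi_z=1$ (if $z\ne y$) and $\xi_\nu=c_\nu$ for $\nu\ne z$; - for $x\neq y$, $x\ne z$, $d=1,2$: $\beta^{(d)}_{xyz}(c)=\gamma_{xy}^{\mathcal N\setminus\{x,y,z\}}([\delta_{c_\nu d}]_{\nu\ne x,y,z})$. 3. With these closed forms inserted for $\alpha$ and $\beta$ in $\Phi$ and $\Psi$, the covariances are as follows. For $i\ne j$, $i\ne l$, $j\neq l$, $$\operatorname{cov}(X_{ij},X_{il})=\frac{\Phi_{ijil}}{m^{n-1}}-\mathbb E[X_{ij}]\,\mathbb E[X_{il}],$$ and for $i\ne j$, $k\ne l$, $i\ne k$, $$\operatorname{cov}(X_{ij},X_{kl})=\frac{1-\delta_{lj}}{m^{n-1}}\,\Phi_{ijkl}+\frac{m-1}{m^{n-1}}\,\Psi_{ijkl}-\mathbb E[X_{ij}]\,\mathbb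 E[X_{kl}].$$ -/

import Mathlib

open MeasureTheory ProbabilityTheory

/-- The deterministic data of the network: `n` nodes at fixed, pairwise distinct positions in `ℝ³`,
transmit powers, integer Nakagami shape parameters, wavelength, path loss coefficient, thermal
noise, SINR threshold and number of slots per frame. -/
structure Network (n : ℕ) where
  /-- node positions -/
  pos : Fin n → EuclideanSpace ℝ (Fin 3)
  pos_injective : Function.Injective pos
  /-- transmit powers -/
  q : Fin n → ℝ
  q_pos : ∀ i, 0 < q i
  /-- integer Nakagami shape parameters -/
  shape : Fin n → ℕ
  shape_pos : ∀ i, 0 < shape i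
  /-- wavelength of the carrier wave -/
  wavelength : ℝ
  wavelength_pos : 0 < wavelength
  /-- path loss coefficient -/
  pathLoss : ℝ
  two_le_pathLoss : 2 ≤ pathLoss
  /-- thermal noise -/
  noise : ℝ
  noise_pos : 0 < noise
  /-- SINR threshold -/
  θ : ℝ
  one_le_θ : 1 ≤ θ
  /-- number of slots per frame -/
  slots : ℕ
  slots_pos : 0 < slots

namespace Network

noncomputable section

variable {n : ℕ} (net : Network n)

/-- Reference distance `r₀ = λ / (4π)`. -/
def refDist : ℝ := net.wavelength / (4 * Real.pi)

/-- `μ_ij = (‖x_i - x_j‖ / r₀) ^ α_PL / q_i`, the inverse of the average power of a transmission of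
node `i` received at node `j`. -/
def mu (i j : Fin n) : ℝ :=
  1 / net.q i * (‖net.pos i - net.pos j‖ / net.refDist) ^ net.pathLoss

section Random

variable {Ω : Type*}

/-- Power `P_ij^k = δ_{S_i k} P_ij` received at `j` from `i` in slot `k`. -/
def slotPower (P : Fin n → Fin n → Ω → ℝ) (S : Fin n → Ω → Fin net.slots)
    (k : Fin net.slots) (i j : Fin n) (ω : Ω) : ℝ :=
  if S i ω = k then P i j ω else 0

/-- Interference `I_ij^k`, the sum of `P_lj^k` over `l ≠ i, j`. -/
def interference (P : Fin n → Fin n → Ω → ℝ) (S : Fin n → Ω → Fin net.slots)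
    (k : Fin net.slots) (i j : Fin n) (ω : Ω) : ℝ :=
  ∑ l ∈ Finset.univ \ {i, j}, net.slotPower P S k l j ω

open Classical in
/-- Indicator `X_ij^k` of excess of the SINR threshold in slot `k`. -/
def slotSuccess (P : Fin n → Fin n → Ω → ℝ) (S : Fin n → Ω → Fin net.slots)
    (k : Fin net.slots) (i j : Fin n) (ω : Ω) : ℝ :=
  if net.θ ≤ net.slotPower P S k i j ω / (net.noise + net.interference P S k i j ω) then 1 else 0

/-- Full-duplex success variable `X_ij`, the sum of `X_ij^k` over all slots `k`. -/
def X (P : Fin n → Fin n → Ω → ℝ) (S : Fin n → Ω → Fin net.slots) (i j : Fin n) (ω : Ω) : ℝ :=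
  ∑ k : Fin net.slots, net.slotSuccess P S k i j ω

/-- The probabilistic model: the slot choices are independent and uniform, the received powers
`P_ij`, `i ≠ j`, are mutually independent and Gamma distributed with density
`m_i ^ m_i μ_ij ^ m_i / Γ(m_i) x ^ (m_i - 1) exp (- m_i x μ_ij)` on `x ≥ 0`, and the family of
powers is independent of the family of slot choices. Nothing is assumed about `P i i`. -/
structure IsNakagamiALOHA [MeasurableSpace Ω] (Pr : Measure Ω)
    (P : Fin n → Fin n → Ω → ℝ) (S : Fin n → Ω → Fin net.slots) : Prop where
  measurable_slot : ∀ i, Measurable (S i)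
  slot_uniform : ∀ i s, Pr.real {ω | S i ω = s} = 1 / net.slots
  slot_indep : iIndepFun S Pr
  measurable_power : ∀ i j, i ≠ j → Measurable (P i j)
  power_law : ∀ i j, i ≠ j →
    Pr.map (P i j) = gammaMeasure (net.shape i) (net.shape i * net.mu i j)
  power_indep : iIndepFun (fun (p : {p : Fin n × Fin n // p.1 ≠ p.2}) => P p.1.1 p.1.2) Pr
  power_indep_slot : IndepFun
    (fun ω (p : {p : Fin n × Fin n // p.1 ≠ p.2}) => P p.1.1 p.1.2 ω) (fun ω i => S i ω) Pr

/-- State coefficient `α_xyz(c)`: the probability that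
`P_xy / (N + ∑_{ν ≠ x,y,z} c_ν P_νy + (1 - δ_xz) P_zy) ≥ θ`. The receiver `y` does not interfere
with itself, so the last summand is also absent for `z = y`. -/
def alpha [MeasurableSpace Ω] (Pr : Measure Ω) (P : Fin n → Fin n → Ω → ℝ)
    (x y z : Fin n) (c : Fin n → ℕ) : ℝ :=
  Pr.real {ω | net.θ ≤ P x y ω / (net.noise + (∑ ν ∈ Finset.univ \ {x, y, z}, (c ν : ℝ) * P ν y ω)
    + (if z = x ∨ z = y then 0 else P z y ω))}

/-- State coefficient `β_xyz^(d)(c)`: the probability that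
`P_xy / (N + ∑_{ν ≠ x,y,z} δ_{c_ν d} P_νy) ≥ θ`. -/
def beta [MeasurableSpace Ω] (Pr : Measure Ω) (P : Fin n → Fin n → Ω → ℝ)
    (d : ℕ) (x y z : Fin n) (c : Fin n → ℕ) : ℝ :=
  Pr.real {ω | net.θ ≤ P x y ω / (net.noise +
    ∑ ν ∈ Finset.univ \ {x, y, z}, (if c ν = d then 1 else 0) * P ν y ω)}

end Random

/-- The closed form `γ_xy^J(ξ)`. Only the values `ξ ν`, `ν ∈ J`, matter. The innermost sum runs over
all families `ℓ` of natural numbers indexed by `J` with sum `t` (extended by `0` outside `J`). -/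
def gamma (x y : Fin n) (J : Finset (Fin n)) (ξ : Fin n → ℝ) : ℝ :=
  Real.exp (-(net.θ * net.shape x * net.mu x y * net.noise)) *
    ∑ s ∈ Finset.range (net.shape x), (net.θ * net.shape x * net.mu x y * net.noise) ^ s *
      ∑ t ∈ Finset.range (s + 1), (net.q x / net.noise) ^ t / ((s - t).factorial : ℝ) *
        ∑ ℓ ∈ Finset.piAntidiag J t, ∏ ν ∈ J,
          ((1 - ξ ν) * (if ℓ ν = 0 then 1 else 0) +
            ((ℓ ν + net.shape ν - 1).choose (ℓ ν) : ℝ) *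
              (ξ ν * (1 / (net.shape ν * net.q x * net.mu ν y)) ^ ℓ ν /
                (net.θ * (net.shape x / net.shape ν) * (net.mu x y / net.mu ν y) + 1) ^
                  (net.shape ν + ℓ ν)))

/-- The total macro states `[c_ν]_{ν ∈ J}` with `c_ν ∈ {0, …, r - 1}`, encoded as functions on all
nodes by the value `0` outside `J`. -/
def macroStates (J : Finset (Fin n)) (r : ℕ) : Finset (Fin n → ℕ) :=
  Fintype.piFinset fun ν => if ν ∈ J then Finset.range r else {0}

/-- State weight `φ(c) = ∏_{ν ∈ J} (m - 1) ^ (1 - c_ν)`, used for `c_ν ∈ {0, 1}`. -/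
def phi (J : Finset (Fin n)) (c : Fin n → ℕ) : ℝ :=
  ∏ ν ∈ J, ((net.slots : ℝ) - 1) ^ (1 - c ν)

/-- State weight `ψ(c) = ∏_{ν ∈ J} (m - 2) ^ δ_{c_ν 0}`. -/
def psi (J : Finset (Fin n)) (c : Fin n → ℕ) : ℝ :=
  ∏ ν ∈ J, ((net.slots : ℝ) - 2) ^ (if c ν = 0 then 1 else 0)

/-- `Φ_ijkl^J(w, a) = ∑_c w(c) a_ijk(c) a_kli(c)`, sum over `c ∈ {0,1}^J`. -/
def Phi (J : Finset (Fin n)) (w : (Fin n → ℕ) → ℝ)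
    (a : Fin n → Fin n → Fin n → (Fin n → ℕ) → ℝ) (i j k l : Fin n) : ℝ :=
  ∑ c ∈ macroStates J 2, w c * a i j k c * a k l i c

/-- `Ψ_ijkl^J(w, b) = ∑_c w(c) b_ijk^(1)(c) b_kli^(2)(c)`, sum over `c ∈ {0,1,2}^J`. -/
def Psi (J : Finset (Fin n)) (w : (Fin n → ℕ) → ℝ)
    (b : ℕ → Fin n → Fin n → Fin n → (Fin n → ℕ) → ℝ) (i j k l : Fin n) : ℝ :=
  ∑ c ∈ macroStates J 3, w c * b 1 i j k c * b 2 k l i c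

/-- Closed form of `α_xyx(c)`: `γ_xy` at the tuple `[c_ν]_{ν ≠ x,y}`. -/
def alphaSame (x y : Fin n) (c : Fin n → ℕ) : ℝ :=
  net.gamma x y (Finset.univ \ {x, y}) fun ν => (c ν : ℝ)

/-- Closed form of `α_xyz(c)`, `z ≠ x`: `γ_xy` at the tuple `[ξ_ν]_{ν ≠ x,y}` with `ξ_z = 1` and
`ξ_ν = c_ν` for `ν ≠ z`. -/
def alphaClosed (x y z : Fin n) (c : Fin n → ℕ) : ℝ :=
  net.gamma x y (Finset.univ \ {x, y}) fun ν => if ν = z then 1 else (c ν : ℝ)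

/-- Closed form of `β_xyz^(d)(c)`: `γ_xy` at the tuple `[δ_{c_ν d}]_{ν ≠ x,y,z}`. -/
def betaClosed (d : ℕ) (x y z : Fin n) (c : Fin n → ℕ) : ℝ :=
  net.gamma x y (Finset.univ \ {x, y, z}) fun ν => if c ν = d then 1 else 0

end

end Network

/-!
The Gamma law with integer shape `m_x` has the Erlang tail `exp (-z) ∑_{s < m_x} z ^ s / s!` with
`z = m_x μ_xy t`. Evaluating it at `t = θ (N + I)` for an independent interference `I` and expanding
`(N + I) ^ s` multinomially leaves exponentially tilted moments of the single interfering powers,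
which are again Gamma integrals; the result is `γ_xy` at the indicator of the set of interferers.

Given the slot choices `s`, a link from `i` to `j` succeeds with a probability that depends only on
the set of nodes sharing the slot of `i`, and two links are independent as soon as they involve
disjoint families of powers. This fails only for two transmitters that share a slot and a receiver,
and then `θ ≥ 1` makes simultaneous success impossible, as each signal would have to exceed the
other. The probability of joint success is thus a function of the macro state of `s`, and `φ` and
`ψ` count the slot choices with a given macro state. For the expectation, the sum over the macro
states collapses because `γ_xy` is affine in each coordinate of `ξ`.
-/

section GammaDistribution

open Real Set Filter Topology

theorem setIntegral_gammaMeasure {E : Type*} [NormedAddCommGroup E] [NormedSpace ℝ E] {a r : ℝ}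
    (ha : 0 < a) (hr : 0 < r) {s : Set ℝ} (hs : MeasurableSet s) (f : ℝ → E) :
    ∫ x in s, f x ∂gammaMeasure a r = ∫ x in s, gammaPDFReal a r x • f x := by
  rw [gammaMeasure, setIntegral_withDensity_eq_setIntegral_toReal_smul (f := gammaPDF a r)
    (measurable_gammaPDFReal a r).ennreal_ofReal (ae_of_all _ fun _ => ENNReal.ofReal_lt_top) _ hs]
  simp only [gammaPDF, ENNReal.toReal_ofReal (gammaPDFReal_nonneg ha hr _)]

theorem ae_nonneg_gammaMeasure (a r : ℝ) : ∀ᵐ x ∂gammaMeasure a r, 0 ≤ x := by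
  simp only [ae_iff, not_le]
  change gammaMeasure a r (Iio 0) = 0
  rw [gammaMeasure, withDensity_apply _ measurableSet_Iio]
  exact lintegral_gammaPDF_of_nonpos le_rfl

theorem integral_pow_mul_exp_neg_gammaMeasure {a r c : ℝ} (ha : 0 < a) (hr : 0 < r) (hc : -r < c)
    (l : ℕ) :
    ∫ x, x ^ l * exp (-(c * x)) ∂gammaMeasure a r
      = Gamma (a + l) / Gamma a * (r ^ a / (r + c) ^ (a + l)) := by
  have hrc : 0 < r + c := by linarith
  have hpdf : ∀ x ∈ Ioi (0 : ℝ), gammaPDFReal a r x • (x ^ l * exp (-(c * x)))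
      = r ^ a / Gamma a * (x ^ (a + l - 1) * exp (-((r + c) * x))) := fun x (hx : 0 < x) => by
    rw [gammaPDFReal, if_pos hx.le, add_sub_right_comm, rpow_add hx, rpow_natCast, add_mul,
      neg_add, exp_add, smul_eq_mul]
    ring
  calc ∫ x, x ^ l * exp (-(c * x)) ∂gammaMeasure a r
      = ∫ x in Ici 0, x ^ l * exp (-(c * x)) ∂gammaMeasure a r := by
        rw [Measure.restrict_eq_self_of_ae_mem (s := Ici 0) (ae_nonneg_gammaMeasure a r)]
    _ = ∫ x in Ioi 0, r ^ a / Gamma a * (x ^ (a + l - 1) * exp (-((r + c) * x))) := by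
        rw [setIntegral_gammaMeasure ha hr measurableSet_Ici, integral_Ici_eq_integral_Ioi,
          setIntegral_congr_fun measurableSet_Ioi hpdf]
    _ = Gamma (a + l) / Gamma a * (r ^ a / (r + c) ^ (a + l)) := by
        rw [integral_const_mul, integral_rpow_mul_exp_neg_mul_Ioi (by positivity) hrc,
          div_rpow zero_le_one hrc.le, one_rpow]
        ring

theorem integral_div_pow_div_factorial_mul_exp_neg_gammaMeasure {k : ℕ} (hk : 0 < k) {r c : ℝ}
    (hr : 0 < r) (hc : -r < c) (q : ℝ) (l : ℕ) :
    ∫ x, (x / q) ^ l / (l.factorial : ℝ) * exp (-(c * x)) ∂gammaMeasure k r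
      = ((l + k - 1).choose l : ℝ) * ((1 / (r * q)) ^ l / (c / r + 1) ^ (k + l)) := by
  obtain ⟨j, rfl⟩ := Nat.exists_eq_succ_of_ne_zero hk.ne'
  have hrc : r + c ≠ 0 := by linarith
  have hGamma : Gamma ((j.succ : ℕ) : ℝ) = j.factorial := by
    rw [Nat.cast_succ, Gamma_nat_eq_factorial]
  have hGamma' : Gamma ((j.succ : ℕ) + l : ℝ) = (l + j).factorial := by
    rw [← Gamma_nat_eq_factorial]
    push_cast
    ring_nf
  have hscale (x : ℝ) : (x / q) ^ l / (l.factorial : ℝ) * exp (-(c * x))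
      = (1 / q) ^ l / (l.factorial : ℝ) * (x ^ l * exp (-(c * x))) := by
    ring
  simp_rw [hscale, integral_const_mul]
  rw [integral_pow_mul_exp_neg_gammaMeasure (by positivity) hr hc, hGamma, hGamma',
    Nat.succ_eq_add_one, ← add_assoc, Nat.add_sub_cancel,
    Nat.cast_choose ℝ (Nat.le_add_right l j), Nat.add_sub_cancel_left, div_add_one hr.ne',
    add_comm c, ← Nat.cast_add, rpow_natCast, rpow_natCast]
  simp only [div_pow, one_pow, pow_add, mul_pow]
  field_simp

/-- The survival function of the sum of `k` independent standard exponential variables (Erlang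
distribution), i.e. the probability of at most `k - 1` points in a Poisson law of parameter `x`. -/
noncomputable def erlangTail (k : ℕ) (x : ℝ) : ℝ :=
  exp (-x) * ∑ s ∈ Finset.range k, x ^ s / (s.factorial : ℝ)

theorem hasDerivAt_erlangTail (k : ℕ) (x : ℝ) :
    HasDerivAt (erlangTail (k + 1)) (-(x ^ k / (k.factorial : ℝ) * exp (-x))) x := by
  have hexp : HasDerivAt (fun x => exp (-x)) (-exp (-x)) x := by
    simpa using (hasDerivAt_id x).neg.exp
  induction k with
  | zero =>
    have hone : erlangTail (0 + 1) = fun x => exp (-x) := by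
      funext x
      simp [erlangTail]
    simpa [hone] using hexp
  | succ k ih =>
    have hsplit : erlangTail (k + 1 + 1)
        = fun x => erlangTail (k + 1) x + exp (-x) * (x ^ (k + 1) / ((k + 1).factorial : ℝ)) := by
      funext x
      rw [erlangTail, Finset.sum_range_succ, mul_add, erlangTail]
    rw [hsplit]
    refine (ih.add (hexp.mul ((hasDerivAt_pow (k + 1) x).div_const _))).congr_deriv ?_
    rw [Nat.factorial_succ]
    push_cast
    field_simp
    simp

theorem tendsto_erlangTail_atTop (k : ℕ) : Tendsto (erlangTail k) atTop (𝓝 0) := by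
  have hterm (s : ℕ) :
      Tendsto (fun x : ℝ => exp (-x) * (x ^ s / (s.factorial : ℝ))) atTop (𝓝 0) := by
    have hdiv := (tendsto_pow_mul_exp_neg_atTop_nhds_zero s).div_const (s.factorial : ℝ)
    rw [zero_div] at hdiv
    exact hdiv.congr fun x => by ring
  have hsum := tendsto_finsetSum (Finset.range k) fun s _ => hterm s
  rw [Finset.sum_const_zero] at hsum
  exact hsum.congr fun x => (Finset.mul_sum _ _ _).symm

theorem gammaMeasure_real_Ici {k : ℕ} (hk : 0 < k) {r t : ℝ} (hr : 0 < r) (ht : 0 ≤ t) :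
    (gammaMeasure k r).real (Ici t) = erlangTail k (r * t) := by
  obtain ⟨j, rfl⟩ := Nat.exists_eq_succ_of_ne_zero hk.ne'
  have hderiv (x : ℝ) : HasDerivAt (fun x => -erlangTail (j + 1) (r * x))
      (r * ((r * x) ^ j / (j.factorial : ℝ) * exp (-(r * x)))) x := by
    exact ((hasDerivAt_erlangTail j (r * x)).comp x
      ((hasDerivAt_id x).const_mul r)).neg.congr_deriv (by ring)
  have hlim : Tendsto (fun x => -erlangTail (j + 1) (r * x)) atTop (𝓝 0) := by
    simpa using ((tendsto_erlangTail_atTop (j + 1)).comp (tendsto_id.const_mul_atTop hr)).neg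
  have hpdf : ∀ x ∈ Ioi t, gammaPDFReal ((j + 1 : ℕ) : ℝ) r x • (1 : ℝ)
      = r * ((r * x) ^ j / (j.factorial : ℝ) * exp (-(r * x))) := fun x (hx : t < x) => by
    rw [gammaPDFReal, if_pos (ht.trans hx.le), rpow_natCast, Nat.cast_succ, add_sub_cancel_right,
      rpow_natCast, Gamma_nat_eq_factorial, smul_eq_mul]
    ring
  calc (gammaMeasure ((j + 1 : ℕ) : ℝ) r).real (Ici t)
      = ∫ _ in Ici t, (1 : ℝ) ∂gammaMeasure ((j + 1 : ℕ) : ℝ) r := by simp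
    _ = ∫ x in Ioi t, r * ((r * x) ^ j / (j.factorial : ℝ) * exp (-(r * x))) := by
        rw [setIntegral_gammaMeasure (by positivity) hr measurableSet_Ici,
          integral_Ici_eq_integral_Ioi, setIntegral_congr_fun measurableSet_Ioi hpdf]
    _ = erlangTail (j + 1) (r * t) := by
        rw [integral_Ioi_of_hasDerivAt_of_nonneg' (fun x _ => hderiv x)
          (fun x hx => by have : 0 ≤ x := ht.trans (le_of_lt hx); positivity) hlim]
        ring

end GammaDistribution

section Threshold

open Real

theorem sum_pow_div_factorial {ι K : Type*} [DecidableEq ι] [Field K] [CharZero K]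
    (J : Finset ι) (y : ι → K) (t : ℕ) :
    (∑ ν ∈ J, y ν) ^ t / (t.factorial : K)
      = ∑ ℓ ∈ J.piAntidiag t, ∏ ν ∈ J, y ν ^ ℓ ν / ((ℓ ν).factorial : K) := by
  rw [Finset.sum_pow_eq_sum_piAntidiag, Finset.sum_div]
  refine Finset.sum_congr rfl fun ℓ hℓ => ?_
  have hfactorial : (∏ ν ∈ J, ((ℓ ν).factorial : K)) * (Nat.multinomial J ℓ : K)
      = (t.factorial : K) := by
    rw [← (Finset.mem_piAntidiag.1 hℓ).1, ← Nat.multinomial_spec J ℓ]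
    push_cast
    rfl
  have hprod : ∏ ν ∈ J, ((ℓ ν).factorial : K) ≠ 0 :=
    Finset.prod_ne_zero_iff.2 fun ν _ => Nat.cast_ne_zero.2 (Nat.factorial_ne_zero _)
  rw [Finset.prod_div_distrib, div_eq_div_iff (Nat.cast_ne_zero.2 t.factorial_ne_zero) hprod,
    ← hfactorial]
  ring

theorem add_pow_div_factorial {K : Type*} [Field K] [CharZero K] (a b : K) (s : ℕ) :
    (a + b) ^ s / (s.factorial : K)
      = ∑ t ∈ Finset.range (s + 1), a ^ (s - t) / ((s - t).factorial : K)
          * (b ^ t / (t.factorial : K)) := by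
  rw [add_comm, add_pow, Finset.sum_div]
  refine Finset.sum_congr rfl fun t ht => ?_
  have hs : (s.factorial : K) ≠ 0 := Nat.cast_ne_zero.2 s.factorial_ne_zero
  rw [Nat.cast_choose K (Nat.lt_succ_iff.1 (Finset.mem_range.1 ht))]
  field_simp

-- The free scale `q` makes the summands match the powers of `q_x` that `γ_xy` carries explicitly.
theorem erlangTail_mul_add_sum {ι : Type*} [DecidableEq ι] (J : Finset ι) (y : ι → ℝ) (c : ℝ)
    {N q : ℝ} (hN : N ≠ 0) (hq : q ≠ 0) (k : ℕ) :
    erlangTail k (c * (N + ∑ ν ∈ J, y ν))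
      = exp (-(c * N)) * ∑ s ∈ Finset.range k, (c * N) ^ s *
          ∑ t ∈ Finset.range (s + 1), (q / N) ^ t / ((s - t).factorial : ℝ) *
            ∑ ℓ ∈ J.piAntidiag t,
              ∏ ν ∈ J, (y ν / q) ^ ℓ ν / ((ℓ ν).factorial : ℝ) * exp (-(c * y ν)) := by
  have hexp : exp (-(c * (N + ∑ ν ∈ J, y ν))) = exp (-(c * N)) * ∏ ν ∈ J, exp (-(c * y ν)) := by
    rw [← exp_sum, Finset.sum_neg_distrib, ← Finset.mul_sum, ← exp_add, mul_add, neg_add]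
  have hpow (s : ℕ) : (c * (N + ∑ ν ∈ J, y ν)) ^ s / (s.factorial : ℝ)
      = (c * N) ^ s * ∑ t ∈ Finset.range (s + 1), (q / N) ^ t / ((s - t).factorial : ℝ) *
          ((∑ ν ∈ J, y ν / q) ^ t / (t.factorial : ℝ)) := by
    rw [mul_add, add_pow_div_factorial, Finset.mul_sum (Finset.range (s + 1))]
    refine Finset.sum_congr rfl fun t ht => ?_
    obtain ⟨u, rfl⟩ := Nat.exists_eq_add_of_le (Nat.lt_succ_iff.1 (Finset.mem_range.1 ht))
    rw [← Finset.sum_div J y q, Nat.add_sub_cancel_left, pow_add]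
    simp only [mul_pow, div_pow]
    field_simp
  simp_rw [erlangTail, hexp, hpow, sum_pow_div_factorial, Finset.prod_mul_distrib]
  simp_rw [← Finset.sum_mul, ← mul_assoc, ← Finset.sum_mul, ← mul_assoc, ← Finset.sum_mul]
  ring

theorem div_pow_div_factorial_mul_exp_neg_le {c q y : ℝ} (hc : 0 < c) (hq : 0 < q) (hy : 0 ≤ y)
    (l : ℕ) : (y / q) ^ l / (l.factorial : ℝ) * exp (-(c * y)) ≤ (1 / (c * q)) ^ l := by
  have hscale : (y / q) ^ l / (l.factorial : ℝ)
      = (1 / (c * q)) ^ l * ((c * y) ^ l / (l.factorial : ℝ)) := by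
    rw [mul_div_assoc', ← mul_pow]
    field_simp
  rw [exp_neg, ← div_eq_mul_inv, div_le_iff₀ (exp_pos _), hscale]
  gcongr
  exact pow_div_factorial_le_exp _ (by positivity) l

variable {Ω : Type*} [MeasurableSpace Ω] {Pr : Measure Ω}

theorem measureReal_setOf_le_eq_integral [IsFiniteMeasure Pr] {X Y : Ω → ℝ} (hX : Measurable X)
    (hY : Measurable Y) (hXY : IndepFun X Y Pr) :
    Pr.real {ω | X ω ≤ Y ω} = ∫ ω, (Pr.map Y).real (Set.Ici (X ω)) ∂Pr := by
  have hle : MeasurableSet {p : ℝ × ℝ | p.1 ≤ p.2} := measurableSet_le measurable_fst measurable_snd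
  calc Pr.real {ω | X ω ≤ Y ω}
      = (Pr.map fun ω => (X ω, Y ω)).real {p : ℝ × ℝ | p.1 ≤ p.2} :=
        (map_measureReal_apply (hX.prodMk hY) hle).symm
    _ = ∫ x, (Pr.map Y).real (Set.Ici x) ∂Pr.map X := by
        rw [hXY.map_prod_eq_prod_map_map hX.aemeasurable hY.aemeasurable, measureReal_def,
          Measure.prod_apply hle,
          ← integral_toReal (measurable_measure_prodMk_left hle).aemeasurable
            (ae_of_all _ fun _ => measure_lt_top _ _)]
        rfl
    _ = ∫ ω, (Pr.map Y).real (Set.Ici (X ω)) ∂Pr :=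
        integral_map hX.aemeasurable (Antitone.measurable fun _ _ hab =>
          measureReal_mono (Set.Ici_subset_Ici.2 hab)).aestronglyMeasurable

theorem measureReal_setOf_le_eq_integral_erlangTail [IsFiniteMeasure Pr] {X Y : Ω → ℝ} {k : ℕ}
    (hk : 0 < k) {r : ℝ} (hr : 0 < r) (hX : Measurable X) (hX0 : ∀ᵐ ω ∂Pr, 0 ≤ X ω)
    (hY : Measurable Y) (hlaw : Pr.map Y = gammaMeasure k r) (hXY : IndepFun X Y Pr) :
    Pr.real {ω | X ω ≤ Y ω} = ∫ ω, erlangTail k (r * X ω) ∂Pr := by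
  rw [measureReal_setOf_le_eq_integral hX hY hXY, hlaw]
  exact integral_congr_ae (hX0.mono fun ω hω => gammaMeasure_real_Ici hk hr hω)

variable {ι : Type*} {J : Finset ι} {Y : ι → Ω → ℝ} {c q : ℝ}

theorem integrable_prod_div_pow_mul_exp_neg [IsFiniteMeasure Pr] (hc : 0 < c) (hq : 0 < q)
    (hY : ∀ ν ∈ J, Measurable (Y ν)) (hY0 : ∀ ν ∈ J, ∀ᵐ ω ∂Pr, 0 ≤ Y ν ω) (ℓ : ι → ℕ) :
    Integrable (fun ω =>
      ∏ ν ∈ J, (Y ν ω / q) ^ ℓ ν / ((ℓ ν).factorial : ℝ) * exp (-(c * Y ν ω))) Pr := by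
  refine Integrable.of_bound (C := ∏ ν ∈ J, (1 / (c * q)) ^ ℓ ν)
    (Finset.measurable_fun_prod J fun ν hν => ?_).aestronglyMeasurable ?_
  · have := hY ν hν
    fun_prop
  · filter_upwards [(Filter.eventually_all_finset J).2 hY0] with ω hω
    have hnonneg : ∀ ν ∈ J, 0 ≤ (Y ν ω / q) ^ ℓ ν / ((ℓ ν).factorial : ℝ) * exp (-(c * Y ν ω)) :=
      fun ν hν => by have := hω ν hν; positivity
    rw [norm_of_nonneg (Finset.prod_nonneg hnonneg)]
    exact Finset.prod_le_prod hnonneg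
      fun ν hν => div_pow_div_factorial_mul_exp_neg_le hc hq (hω ν hν) _

theorem integral_prod_div_pow_mul_exp_neg (hY : ∀ ν ∈ J, Measurable (Y ν))
    (hind : iIndepFun (fun ν : J => Y ν) Pr) (c q : ℝ) (ℓ : ι → ℕ) :
    ∫ ω, ∏ ν ∈ J, (Y ν ω / q) ^ ℓ ν / ((ℓ ν).factorial : ℝ) * exp (-(c * Y ν ω)) ∂Pr
      = ∏ ν ∈ J, ∫ ω, (Y ν ω / q) ^ ℓ ν / ((ℓ ν).factorial : ℝ) * exp (-(c * Y ν ω)) ∂Pr := by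
  simp_rw [← Finset.prod_coe_sort J]
  exact iIndepFun.integral_fun_prod_comp (X := fun ν : J => Y ν)
    (f := fun ν x => (x / q) ^ ℓ ν / ((ℓ ν).factorial : ℝ) * exp (-(c * x)))
    hind (fun ν => (hY ν ν.2).aemeasurable) fun ν => by fun_prop

theorem integral_erlangTail_mul_add_sum [DecidableEq ι] [IsFiniteMeasure Pr] (hc : 0 < c)
    (hq : 0 < q) {N : ℝ} (hN : N ≠ 0) (hY : ∀ ν ∈ J, Measurable (Y ν))
    (hY0 : ∀ ν ∈ J, ∀ᵐ ω ∂Pr, 0 ≤ Y ν ω) (hind : iIndepFun (fun ν : J => Y ν) Pr) (k : ℕ) :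
    ∫ ω, erlangTail k (c * (N + ∑ ν ∈ J, Y ν ω)) ∂Pr
      = exp (-(c * N)) * ∑ s ∈ Finset.range k, (c * N) ^ s *
          ∑ t ∈ Finset.range (s + 1), (q / N) ^ t / ((s - t).factorial : ℝ) *
            ∑ ℓ ∈ J.piAntidiag t, ∏ ν ∈ J,
              ∫ ω, (Y ν ω / q) ^ ℓ ν / ((ℓ ν).factorial : ℝ) * exp (-(c * Y ν ω)) ∂Pr := by
  have hint (t : ℕ) := integrable_finsetSum (J.piAntidiag t) fun ℓ _ =>
    integrable_prod_div_pow_mul_exp_neg hc hq hY hY0 ℓ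
  simp_rw [erlangTail_mul_add_sum J _ c hN hq.ne', ← integral_prod_div_pow_mul_exp_neg hY hind]
  rw [integral_const_mul, integral_finsetSum _ fun s _ =>
    (integrable_finsetSum _ fun t _ => (hint t).const_mul _).const_mul _]
  simp_rw [integral_const_mul]
  congr! 3 with s
  rw [integral_finsetSum _ fun t _ => (hint t).const_mul _]
  simp_rw [integral_const_mul]
  congr! 3 with t
  exact integral_finsetSum _ fun ℓ _ => integrable_prod_div_pow_mul_exp_neg hc hq hY hY0 ℓ

end Threshold

section

variable {Ω α : Type*}

theorem setOf_mem_comp_eq_iUnion (V : Ω → α) (B : α → Set Ω) :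
    {ω | ω ∈ B (V ω)} = ⋃ a, V ⁻¹' {a} ∩ B a := by
  ext ω
  simp

variable {m mΩ : MeasurableSpace Ω} {Pr : Measure Ω} [MeasurableSpace α]
  [MeasurableSingletonClass α] {V : Ω → α} {B : α → Set Ω}

theorem measurableSet_setOf_mem_comp [Countable α] (hV : Measurable V)
    (hB : ∀ a, MeasurableSet (B a)) : MeasurableSet {ω | ω ∈ B (V ω)} :=
  setOf_mem_comp_eq_iUnion V B ▸ .iUnion fun a => (hV (.singleton a)).inter (hB a)

theorem measureReal_setOf_mem_comp [Fintype α] [IsFiniteMeasure Pr] (hm : m ≤ mΩ)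
    (hV : Measurable V) (hind : Indep (MeasurableSpace.comap V inferInstance) m Pr)
    (hB : ∀ a, MeasurableSet[m] (B a)) :
    Pr.real {ω | ω ∈ B (V ω)} = ∑ a, Pr.real (V ⁻¹' {a}) * Pr.real (B a) := by
  have hprod (a : α) : Pr (V ⁻¹' {a} ∩ B a) = Pr (V ⁻¹' {a}) * Pr (B a) :=
    (Indep_iff _ _ _).1 hind _ _ ⟨{a}, .singleton a, rfl⟩ (hB a)
  have hdisj : Pairwise (Function.onFun Disjoint fun a => V ⁻¹' {a} ∩ B a) := fun a b hab =>
    Set.disjoint_left.2 fun _ ha hb => hab (ha.1.symm.trans hb.1)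
  rw [setOf_mem_comp_eq_iUnion,
    measureReal_iUnion_fintype hdisj fun a => (hV (.singleton a)).inter (hm _ (hB a))]
  simp only [measureReal_def, hprod, ENNReal.toReal_mul]

end

theorem sum_piFinset_comp {ι α β R : Type*} [Fintype ι] [DecidableEq ι] [DecidableEq β]
    [CommSemiring R] {A : ι → Finset α} {B : ι → Finset β} {f : ι → α → β}
    (hf : ∀ i, ∀ a ∈ A i, f i a ∈ B i) (F : (ι → β) → R) :
    ∑ s ∈ Fintype.piFinset A, F (fun i => f i (s i))
      = ∑ c ∈ Fintype.piFinset B, (∏ i, (((A i).filter fun a => f i a = c i).card : R)) * F c := by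
  have hmaps : ∀ s ∈ Fintype.piFinset A, (fun i => f i (s i)) ∈ Fintype.piFinset B := fun s hs =>
    Fintype.mem_piFinset.2 fun i => hf i _ (Fintype.mem_piFinset.1 hs i)
  have hfiber (c : ι → β) : (Fintype.piFinset A).filter (fun s => (fun i => f i (s i)) = c)
      = Fintype.piFinset fun i => (A i).filter fun a => f i a = c i := by
    ext s
    simp [funext_iff, forall_and]
  rw [← Finset.sum_fiberwise_of_maps_to hmaps]
  refine Finset.sum_congr rfl fun c _ => ?_
  rw [← Nat.cast_prod, ← Fintype.card_piFinset, ← hfiber, ← nsmul_eq_mul, ← Finset.sum_const]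
  exact Finset.sum_congr rfl fun s hs => by rw [(Finset.mem_filter.1 hs).2]

namespace Network

variable {n : ℕ}

theorem mu_pos (net : Network n) {i j : Fin n} (hij : i ≠ j) : 0 < net.mu i j := by
  have hq := net.q_pos i
  have hdist : 0 < ‖net.pos i - net.pos j‖ :=
    norm_pos_iff.2 (sub_ne_zero.2 (net.pos_injective.ne hij))
  have href : 0 < net.refDist := div_pos net.wavelength_pos (by positivity)
  unfold mu
  positivity

theorem cast_shape_pos (net : Network n) (i : Fin n) : (0 : ℝ) < net.shape i :=
  Nat.cast_pos.2 (net.shape_pos i)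

theorem cast_slots_pos (net : Network n) : (0 : ℝ) < net.slots := Nat.cast_pos.2 net.slots_pos

theorem θ_pos (net : Network n) : 0 < net.θ := zero_lt_one.trans_le net.one_le_θ

/-- The exponentially tilted moment `E[(P_νy / q_x) ^ l / l! exp (- θ m_x μ_xy P_νy)]` of the power
of the interferer `ν`, in the closed form in which it occurs in `γ_xy`. -/
noncomputable def tiltedMoment (net : Network n) (x y ν : Fin n) (l : ℕ) : ℝ :=
  ((l + net.shape ν - 1).choose l : ℝ) * ((1 / (net.shape ν * net.q x * net.mu ν y)) ^ l /
    (net.θ * (net.shape x / net.shape ν) * (net.mu x y / net.mu ν y) + 1) ^ (net.shape ν + l))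

theorem gamma_eq (net : Network n) (x y : Fin n) (J : Finset (Fin n)) (ξ : Fin n → ℝ) :
    net.gamma x y J ξ = Real.exp (-(net.θ * net.shape x * net.mu x y * net.noise)) *
      ∑ s ∈ Finset.range (net.shape x), (net.θ * net.shape x * net.mu x y * net.noise) ^ s *
        ∑ t ∈ Finset.range (s + 1), (net.q x / net.noise) ^ t / ((s - t).factorial : ℝ) *
          ∑ ℓ ∈ Finset.piAntidiag J t, ∏ ν ∈ J,
            ((1 - ξ ν) * (if ℓ ν = 0 then 1 else 0) + ξ ν * net.tiltedMoment x y ν (ℓ ν)) := by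
  simp only [gamma, tiltedMoment, mul_div_assoc, mul_left_comm (ξ _)]

theorem gamma_congr (net : Network n) {x y : Fin n} {J : Finset (Fin n)} {ξ ξ' : Fin n → ℝ}
    (h : ∀ ν ∈ J, ξ ν = ξ' ν) : net.gamma x y J ξ = net.gamma x y J ξ' := by
  unfold gamma
  congr! 6 with s _ t _ ℓ _
  exact Finset.prod_congr rfl fun _ hν => by rw [h _ hν]

section PowerSigma

variable {Ω : Type*}

/-- The σ-algebra generated by the powers `P_ij`, `i ≠ j`, with `(i, j) ∈ U`. -/
abbrev powerSigma (P : Fin n → Fin n → Ω → ℝ) (U : Set (Fin n × Fin n)) : MeasurableSpace Ω :=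
  ⨆ p ∈ {p : {p : Fin n × Fin n // p.1 ≠ p.2} | p.1 ∈ U},
    MeasurableSpace.comap (P p.1.1 p.1.2) inferInstance

/-- The event that the link from `x` to `y` reaches the threshold when exactly the nodes in `T`
interfere. -/
def successSet (net : Network n) (P : Fin n → Fin n → Ω → ℝ) (x y : Fin n) (T : Finset (Fin n)) :
    Set Ω :=
  {ω | net.θ ≤ P x y ω / (net.noise + ∑ ν ∈ T, P ν y ω)}

variable (P : Fin n → Fin n → Ω → ℝ) {U : Set (Fin n × Fin n)} {x y : Fin n} {T : Finset (Fin n)}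

theorem measurable_powerSigma (hxy : x ≠ y) (hU : (x, y) ∈ U) :
    Measurable[powerSigma P U] (P x y) :=
  measurable_iff_comap_le.2 <| le_iSup₂_of_le
    (f := fun (p : {p : Fin n × Fin n // p.1 ≠ p.2})
      (_ : p ∈ {p : {p : Fin n × Fin n // p.1 ≠ p.2} | p.1 ∈ U}) =>
        MeasurableSpace.comap (P p.1.1 p.1.2) inferInstance) ⟨(x, y), hxy⟩ hU le_rfl

theorem measurable_sum_powerSigma (hy : y ∉ T) (hU : (T : Set (Fin n)) ×ˢ {y} ⊆ U) :
    Measurable[powerSigma P U] fun ω => ∑ ν ∈ T, P ν y ω :=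
  Finset.measurable_fun_sum T fun _ hν =>
    measurable_powerSigma P (ne_of_mem_of_not_mem hν hy) (hU ⟨hν, rfl⟩)

theorem measurableSet_powerSigma_successSet (net : Network n) (hxy : x ≠ y) (hy : y ∉ T)
    (hU : ((insert x T : Finset (Fin n)) : Set (Fin n)) ×ˢ {y} ⊆ U) :
    MeasurableSet[powerSigma P U] (net.successSet P x y T) := by
  let := powerSigma P U
  have hsignal : Measurable (P x y) :=
    measurable_powerSigma P hxy (hU ⟨Finset.mem_insert_self x T, rfl⟩)
  have hsum : Measurable fun ω => ∑ ν ∈ T, P ν y ω := measurable_sum_powerSigma P hy fun p hp =>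
    hU ⟨Finset.mem_insert_of_mem hp.1, hp.2⟩
  exact measurableSet_le measurable_const (hsignal.div (hsum.const_add _))

end PowerSigma

namespace IsNakagamiALOHA

variable {net : Network n} {Ω : Type*} [MeasurableSpace Ω] {Pr : Measure Ω}
  {P : Fin n → Fin n → Ω → ℝ} {S : Fin n → Ω → Fin net.slots}

theorem powerSigma_le (h : net.IsNakagamiALOHA Pr P S) (U : Set (Fin n × Fin n)) :
    powerSigma P U ≤ ‹MeasurableSpace Ω› :=
  iSup₂_le fun p _ => (h.measurable_power _ _ p.2).comap_le

theorem indep_powerSigma (h : net.IsNakagamiALOHA Pr P S) {U V : Set (Fin n × Fin n)}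
    (hUV : Disjoint U V) : Indep (powerSigma P U) (powerSigma P V) Pr :=
  indep_iSup_of_disjoint (fun p => (h.measurable_power _ _ p.2).comap_le) h.power_indep.iIndep
    (hUV.preimage Subtype.val)

theorem measurableSet_successSet (h : net.IsNakagamiALOHA Pr P S) {x y : Fin n}
    {T : Finset (Fin n)} (hxy : x ≠ y) (hy : y ∉ T) : MeasurableSet (net.successSet P x y T) :=
  h.powerSigma_le Set.univ _
    (measurableSet_powerSigma_successSet P net hxy hy (Set.subset_univ _))

theorem ae_nonneg_power (h : net.IsNakagamiALOHA Pr P S) {i j : Fin n} (hij : i ≠ j) :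
    ∀ᵐ ω ∂Pr, 0 ≤ P i j ω :=
  ae_of_ae_map (h.measurable_power i j hij).aemeasurable
    (h.power_law i j hij ▸ ae_nonneg_gammaMeasure _ _)

theorem ae_nonneg_sum_power (h : net.IsNakagamiALOHA Pr P S) {y : Fin n} {T : Finset (Fin n)}
    (hy : y ∉ T) : ∀ᵐ ω ∂Pr, ∀ ν ∈ T, 0 ≤ P ν y ω :=
  (Filter.eventually_all_finset T).2 fun _ hν => h.ae_nonneg_power (ne_of_mem_of_not_mem hν hy)

theorem integral_tilted_power (h : net.IsNakagamiALOHA Pr P S) {x y ν : Fin n} (hxy : x ≠ y)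
    (hνy : ν ≠ y) (l : ℕ) :
    ∫ ω, (P ν y ω / net.q x) ^ l / (l.factorial : ℝ)
        * Real.exp (-(net.θ * net.shape x * net.mu x y * P ν y ω)) ∂Pr
      = net.tiltedMoment x y ν l := by
  have hμx := net.mu_pos hxy
  have hμν := net.mu_pos hνy
  have hmx := net.cast_shape_pos x
  have hmν := net.cast_shape_pos ν
  have hθ := net.θ_pos
  have hrate : -(net.shape ν * net.mu ν y) < net.θ * net.shape x * net.mu x y :=
    (neg_lt_zero.2 (by positivity)).trans (by positivity)
  have hratio : net.θ * net.shape x * net.mu x y / (net.shape ν * net.mu ν y)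
      = net.θ * (net.shape x / net.shape ν) * (net.mu x y / net.mu ν y) := by
    field_simp
  calc ∫ ω, (P ν y ω / net.q x) ^ l / (l.factorial : ℝ)
        * Real.exp (-(net.θ * net.shape x * net.mu x y * P ν y ω)) ∂Pr
      = ∫ p, (p / net.q x) ^ l / (l.factorial : ℝ)
        * Real.exp (-(net.θ * net.shape x * net.mu x y * p)) ∂Pr.map (P ν y) := by
        rw [integral_map (h.measurable_power ν y hνy).aemeasurable (by fun_prop)]
    _ = net.tiltedMoment x y ν l := by
        rw [h.power_law ν y hνy, integral_div_pow_div_factorial_mul_exp_neg_gammaMeasure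
          (net.shape_pos ν) (by positivity) hrate, hratio, tiltedMoment, mul_right_comm]

theorem indepFun_sum_power (h : net.IsNakagamiALOHA Pr P S) {x y : Fin n} {T : Finset (Fin n)}
    (hxy : x ≠ y) (hx : x ∉ T) (hy : y ∉ T) :
    IndepFun (fun ω => ∑ ν ∈ T, P ν y ω) (P x y) Pr := by
  have hdisj : Disjoint ((T : Set (Fin n)) ×ˢ {y}) {(x, y)} :=
    Set.disjoint_singleton_right.2 fun hmem => hx hmem.1
  exact indep_of_indep_of_le_left
    (indep_of_indep_of_le_right (h.indep_powerSigma hdisj)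
      (measurable_powerSigma P hxy (Set.mem_singleton _)).comap_le)
    (measurable_sum_powerSigma P hy Set.Subset.rfl).comap_le

theorem iIndepFun_power (h : net.IsNakagamiALOHA Pr P S) {y : Fin n} {J : Finset (Fin n)}
    (hy : y ∉ J) : iIndepFun (fun ν : J => P ν y) Pr := by
  have hne (ν : J) : ν.1 ≠ y := ne_of_mem_of_not_mem ν.2 hy
  exact h.power_indep.precomp
    (g := fun ν : J => (⟨(ν.1, y), hne ν⟩ : {p : Fin n × Fin n // p.1 ≠ p.2}))
    fun a b hab => Subtype.ext (congrArg (fun p => p.1.1) hab)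

theorem successSet_ae_eq (h : net.IsNakagamiALOHA Pr P S) (x : Fin n) {y : Fin n}
    {T : Finset (Fin n)} (hy : y ∉ T) :
    net.successSet P x y T
      =ᵐ[Pr] {ω | net.θ * (net.noise + ∑ ν ∈ T, P ν y ω) ≤ P x y ω} := by
  filter_upwards [h.ae_nonneg_sum_power hy] with ω hω
  exact propext (le_div_iff₀ (add_pos_of_pos_of_nonneg net.noise_pos (Finset.sum_nonneg hω)))

theorem measureReal_successSet_eq_integral_erlangTail [IsProbabilityMeasure Pr]
    (h : net.IsNakagamiALOHA Pr P S) {x y : Fin n} {T : Finset (Fin n)} (hxy : x ≠ y) (hx : x ∉ T)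
    (hy : y ∉ T) :
    Pr.real (net.successSet P x y T) = ∫ ω, erlangTail (net.shape x)
      (net.θ * net.shape x * net.mu x y * (net.noise + ∑ ν ∈ T, P ν y ω)) ∂Pr := by
  have hsum : Measurable fun ω => ∑ ν ∈ T, P ν y ω :=
    Finset.measurable_fun_sum T fun ν hν => h.measurable_power ν y (ne_of_mem_of_not_mem hν hy)
  have hθ := net.θ_pos
  have hN := net.noise_pos
  have hrate : 0 < net.shape x * net.mu x y := mul_pos (net.cast_shape_pos x) (net.mu_pos hxy)
  have hnonneg : ∀ᵐ ω ∂Pr, 0 ≤ net.θ * (net.noise + ∑ ν ∈ T, P ν y ω) := by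
    filter_upwards [h.ae_nonneg_sum_power hy] with ω hω
    have := Finset.sum_nonneg hω
    positivity
  rw [measureReal_congr (h.successSet_ae_eq x hy),
    measureReal_setOf_le_eq_integral_erlangTail (net.shape_pos x) hrate
      ((hsum.const_add _).const_mul _) hnonneg (h.measurable_power x y hxy) (h.power_law x y hxy)
      ((h.indepFun_sum_power hxy hx hy).comp
        ((measurable_const_add net.noise).const_mul net.θ) measurable_id)]
  congr! 3 with ω
  ring

theorem measureReal_successSet [IsProbabilityMeasure Pr] (h : net.IsNakagamiALOHA Pr P S)
    {x y : Fin n} (hxy : x ≠ y) {T J : Finset (Fin n)} (hTJ : T ⊆ J) (hx : x ∉ J) (hy : y ∉ J)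
    {ξ : Fin n → ℝ} (hξ : ∀ ν ∈ J, ξ ν = if ν ∈ T then 1 else 0) :
    Pr.real (net.successSet P x y T) = net.gamma x y J ξ := by
  have hmoment (ν : Fin n) (hν : ν ∈ J) (l : ℕ) :
      ∫ ω, ((if ν ∈ T then P ν y ω else 0) / net.q x) ^ l / (l.factorial : ℝ)
          * Real.exp (-(net.θ * net.shape x * net.mu x y * if ν ∈ T then P ν y ω else 0)) ∂Pr
        = (1 - ξ ν) * (if l = 0 then 1 else 0) + ξ ν * net.tiltedMoment x y ν l := by
    by_cases hνT : ν ∈ T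
    · simp [hξ ν hν, hνT, h.integral_tilted_power hxy (ne_of_mem_of_not_mem hν hy)]
    · cases l <;> simp [hξ ν hν, hνT]
  have hsum (ω : Ω) : ∑ ν ∈ T, P ν y ω = ∑ ν ∈ J, if ν ∈ T then P ν y ω else 0 := by
    rw [Finset.sum_ite_mem, Finset.inter_eq_right.2 hTJ]
  have hrate : 0 < net.θ * net.shape x * net.mu x y :=
    mul_pos (mul_pos net.θ_pos (net.cast_shape_pos x)) (net.mu_pos hxy)
  have hmeas (ν : Fin n) (hν : ν ∈ J) : Measurable fun ω => if ν ∈ T then P ν y ω else 0 :=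
    Measurable.ite (.const _) (h.measurable_power ν y (ne_of_mem_of_not_mem hν hy)) measurable_const
  have hnonneg (ν : Fin n) (hν : ν ∈ J) : ∀ᵐ ω ∂Pr, 0 ≤ if ν ∈ T then P ν y ω else 0 := by
    filter_upwards [h.ae_nonneg_power (ne_of_mem_of_not_mem hν hy)] with ω hω
    split_ifs <;> simp [hω]
  have hind : iIndepFun (fun ν : J => fun ω => if ν.1 ∈ T then P ν y ω else 0) Pr :=
    (h.iIndepFun_power hy).comp (fun ν p => if ν.1 ∈ T then p else 0) fun ν =>
      Measurable.ite (.const _) measurable_id measurable_const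
  rw [h.measureReal_successSet_eq_integral_erlangTail hxy (fun hxT => hx (hTJ hxT))
    fun hyT => hy (hTJ hyT)]
  simp_rw [hsum]
  rw [integral_erlangTail_mul_add_sum hrate (net.q_pos x) net.noise_pos.ne' hmeas hnonneg hind,
    gamma_eq]
  congr! 6 with s _ t _ ℓ _
  exact Finset.prod_congr rfl fun ν hν => hmoment ν hν (ℓ ν)

theorem measureReal_successSet_inter (h : net.IsNakagamiALOHA Pr P S)
    {i j k l : Fin n} {T T' : Finset (Fin n)} (hij : i ≠ j) (hkl : k ≠ l) (hj : j ∉ T)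
    (hl : l ∉ T') (hdisj : j = l → Disjoint (insert i T) (insert k T')) :
    Pr.real (net.successSet P i j T ∩ net.successSet P k l T')
      = Pr.real (net.successSet P i j T) * Pr.real (net.successSet P k l T') := by
  have hUV : Disjoint (((insert i T : Finset (Fin n)) : Set (Fin n)) ×ˢ {j})
      (((insert k T' : Finset (Fin n)) : Set (Fin n)) ×ˢ {l}) := by
    rw [Set.disjoint_prod, Set.disjoint_singleton, Finset.disjoint_coe]
    exact (eq_or_ne j l).imp hdisj id
  simp only [measureReal_def, ← ENNReal.toReal_mul]
  rw [(Indep_iff _ _ _).1 (h.indep_powerSigma hUV) _ _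
    (measurableSet_powerSigma_successSet P net hij hj Set.Subset.rfl)
    (measurableSet_powerSigma_successSet P net hkl hl Set.Subset.rfl)]

theorem ae_lt_of_mem_successSet (h : net.IsNakagamiALOHA Pr P S) (i : Fin n) {j k : Fin n}
    {T : Finset (Fin n)} (hj : j ∉ T) (hk : k ∈ T) :
    ∀ᵐ ω ∂Pr, ω ∈ net.successSet P i j T → P k j ω < P i j ω := by
  filter_upwards [h.ae_nonneg_sum_power hj, (h.successSet_ae_eq i hj).mem_iff] with ω hω hiff hmem
  have hle : P k j ω ≤ ∑ ν ∈ T, P ν j ω := Finset.single_le_sum hω hk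
  have hsum : net.noise + ∑ ν ∈ T, P ν j ω ≤ net.θ * (net.noise + ∑ ν ∈ T, P ν j ω) :=
    le_mul_of_one_le_left (add_nonneg net.noise_pos.le (Finset.sum_nonneg hω)) net.one_le_θ
  exact (lt_add_of_pos_of_le net.noise_pos hle).trans_le (hsum.trans (hiff.1 hmem))

theorem measureReal_successSet_inter_eq_zero (h : net.IsNakagamiALOHA Pr P S)
    {i j k : Fin n} {T T' : Finset (Fin n)} (hj : j ∉ T) (hj' : j ∉ T') (hk : k ∈ T)
    (hi : i ∈ T') : Pr.real (net.successSet P i j T ∩ net.successSet P k j T') = 0 := by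
  rw [measureReal_def, measure_eq_zero_iff_ae_notMem.2, ENNReal.toReal_zero]
  filter_upwards [h.ae_lt_of_mem_successSet i hj hk, h.ae_lt_of_mem_successSet k hj' hi]
    with ω hki hik hmem
  exact lt_asymm (hki hmem.1) (hik hmem.2)

end IsNakagamiALOHA

theorem lt_of_mem_macroStates {J : Finset (Fin n)} {r : ℕ} (hr : 0 < r) {c : Fin n → ℕ}
    (hc : c ∈ macroStates J r) (ν : Fin n) : c ν < r := by
  have hν := Fintype.mem_piFinset.1 hc ν
  split_ifs at hν
  · exact Finset.mem_range.1 hν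
  · rwa [Finset.mem_singleton.1 hν]

theorem sum_mul_add_ite_eq_sum_filter {c : Fin n → ℕ} (hc : ∀ ν, c ν < 2) (x y z : Fin n)
    (p : Fin n → ℝ) :
    ∑ ν ∈ Finset.univ \ {x, y, z}, (c ν : ℝ) * p ν + (if z = x ∨ z = y then 0 else p z)
      = ∑ ν ∈ (Finset.univ \ {x, y}).filter (fun ν => ν = z ∨ c ν = 1), p ν := by
  have herase : (Finset.univ \ {x, y, z} : Finset (Fin n)) = (Finset.univ \ {x, y}).erase z := by
    ext ν
    simp only [Finset.mem_sdiff, Finset.mem_univ, Finset.mem_insert, Finset.mem_singleton,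
      Finset.mem_erase]
    tauto
  have hterm : ∀ ν ∈ (Finset.univ \ {x, y}).erase z,
      (c ν : ℝ) * p ν = if ν = z ∨ c ν = 1 then p ν else 0 := fun ν hν => by
    have hcν := hc ν
    interval_cases c ν <;> simp [Finset.ne_of_mem_erase hν]
  rw [herase, Finset.sum_congr rfl hterm, Finset.sum_filter]
  by_cases hz : z ∈ Finset.univ \ {x, y}
  · rw [← Finset.sum_erase_add _ _ hz, if_neg (by simpa using hz), if_pos (Or.inl rfl)]
  · rw [Finset.erase_eq_of_notMem hz, if_pos (by simpa [or_iff_not_imp_left] using hz), add_zero]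

theorem alphaClosed_self (net : Network n) (x y : Fin n) (c : Fin n → ℕ) :
    net.alphaClosed x y x c = net.alphaSame x y c :=
  net.gamma_congr fun ν hν => if_neg fun hx => by simp [hx] at hν

/-- The interferers of the link from `i` to `j` under the slot choice `s`. -/
def interferers {m : ℕ} (s : Fin n → Fin m) (i j : Fin n) : Finset (Fin n) :=
  (Finset.univ \ {i, j}).filter fun ν => s ν = s i

theorem mem_interferers {m : ℕ} {s : Fin n → Fin m} {i j ν : Fin n} :
    ν ∈ interferers s i j ↔ (ν ≠ i ∧ ν ≠ j) ∧ s ν = s i := by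
  simp [interferers]

theorem notMem_interferers {m : ℕ} (s : Fin n → Fin m) (i j : Fin n) : j ∉ interferers s i j :=
  fun hj => (mem_interferers.1 hj).1.2 rfl

theorem disjoint_insert_interferers {m : ℕ} {s : Fin n → Fin m} {i k : Fin n} (hs : s i ≠ s k)
    (j l : Fin n) : Disjoint (insert i (interferers s i j)) (insert k (interferers s k l)) := by
  have hslot {a b ν : Fin n} (hν : ν ∈ insert a (interferers s a b)) : s ν = s a := by
    rcases Finset.mem_insert.1 hν with rfl | hν
    exacts [rfl, (mem_interferers.1 hν).2]
  exact Finset.disjoint_left.2 fun ν hi hk => hs ((hslot hi).symm.trans (hslot hk))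

-- Only the slot chosen by the transmitter can contribute to `X_ij`, since `θ > 0`.
theorem X_eq_indicator (net : Network n) {Ω : Type*} (P : Fin n → Fin n → Ω → ℝ)
    (S : Fin n → Ω → Fin net.slots) (i j : Fin n) :
    net.X P S i j
      = {ω | ω ∈ net.successSet P i j (interferers (fun ν => S ν ω) i j)}.indicator 1 := by
  classical
  ext ω
  rw [X, Finset.sum_eq_single (S i ω)]
  · simp only [slotSuccess, slotPower, interference, Set.indicator_apply, successSet,
      Set.mem_ofPred_eq, if_true, interferers, Finset.sum_filter, Pi.one_apply]
  · intro k _ hk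
    simp [slotSuccess, slotPower, hk.symm, net.θ_pos.not_ge]
  · simp

namespace IsNakagamiALOHA

variable {net : Network n} {Ω : Type*} [MeasurableSpace Ω] {Pr : Measure Ω}
  {P : Fin n → Fin n → Ω → ℝ} {S : Fin n → Ω → Fin net.slots}

theorem alpha_eq_alphaClosed [IsProbabilityMeasure Pr] (h : net.IsNakagamiALOHA Pr P S)
    {x y : Fin n} (hxy : x ≠ y) (z : Fin n) {c : Fin n → ℕ} (hc : ∀ ν, c ν < 2) :
    net.alpha Pr P x y z c = net.alphaClosed x y z c := by
  simp_rw [alpha, add_assoc, sum_mul_add_ite_eq_sum_filter hc x y z fun ν => P ν y _]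
  refine h.measureReal_successSet hxy (Finset.filter_subset _ _) (by simp) (by simp) fun ν hν => ?_
  have hcν := hc ν
  simp only [Finset.mem_filter, hν, true_and]
  interval_cases c ν <;> simp

theorem beta_eq_betaClosed [IsProbabilityMeasure Pr] (h : net.IsNakagamiALOHA Pr P S) {x y : Fin n}
    (hxy : x ≠ y) (d : ℕ) (z : Fin n) (c : Fin n → ℕ) :
    net.beta Pr P d x y z c = net.betaClosed d x y z c := by
  simp_rw [beta, ite_mul, one_mul, zero_mul, ← Finset.sum_filter]
  exact h.measureReal_successSet hxy (Finset.filter_subset _ _) (by simp) (by simp)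
    fun ν hν => by simp only [Finset.mem_filter, hν, true_and]

theorem measurable_slots (h : net.IsNakagamiALOHA Pr P S) : Measurable fun ω ν => S ν ω :=
  measurable_pi_lambda _ h.measurable_slot

theorem measureReal_slots_eq (h : net.IsNakagamiALOHA Pr P S) (s : Fin n → Fin net.slots) :
    Pr.real ((fun ω ν => S ν ω) ⁻¹' {s}) = 1 / (net.slots : ℝ) ^ n := by
  have hinter : (fun ω ν => S ν ω) ⁻¹' {s} = ⋂ ν, S ν ⁻¹' {s ν} := by
    ext ω
    simp [funext_iff]
  have huniform (ν : Fin n) : (Pr (S ν ⁻¹' {s ν})).toReal = 1 / net.slots := h.slot_uniform ν (s ν)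
  rw [hinter, measureReal_def, h.slot_indep.meas_iInter fun ν => ⟨{s ν}, .singleton _, rfl⟩,
    ENNReal.toReal_prod]
  simp [huniform]

theorem measureReal_setOf_mem_slots [IsProbabilityMeasure Pr] (h : net.IsNakagamiALOHA Pr P S)
    {B : (Fin n → Fin net.slots) → Set Ω} (hB : ∀ s, MeasurableSet[powerSigma P Set.univ] (B s)) :
    Pr.real {ω | ω ∈ B fun ν => S ν ω} = (∑ s, Pr.real (B s)) / (net.slots : ℝ) ^ n := by
  have hind : Indep (powerSigma P Set.univ)
      (MeasurableSpace.comap (fun ω ν => S ν ω) inferInstance) Pr := by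
    refine indep_of_indep_of_le_left h.power_indep_slot (iSup₂_le fun p _ => ?_)
    rintro _ ⟨A, hA, rfl⟩
    exact ⟨(fun f => f p) ⁻¹' A, measurable_pi_apply p hA, rfl⟩
  rw [measureReal_setOf_mem_comp (h.powerSigma_le _) h.measurable_slots hind.symm hB,
    Finset.sum_div]
  exact Finset.sum_congr rfl fun s _ => by
    rw [h.measureReal_slots_eq, one_div, div_eq_inv_mul]

theorem measurableSet_success (h : net.IsNakagamiALOHA Pr P S) {i j : Fin n} (hij : i ≠ j) :
    MeasurableSet {ω | ω ∈ net.successSet P i j (interferers (fun ν => S ν ω) i j)} :=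
  measurableSet_setOf_mem_comp (B := fun s => net.successSet P i j (interferers s i j))
    h.measurable_slots fun s => h.measurableSet_successSet hij (notMem_interferers s i j)

theorem integral_X [IsProbabilityMeasure Pr] (h : net.IsNakagamiALOHA Pr P S) {i j : Fin n}
    (hij : i ≠ j) :
    ∫ ω, net.X P S i j ω ∂Pr
      = (∑ s : Fin n → Fin net.slots, Pr.real (net.successSet P i j (interferers s i j)))
        / (net.slots : ℝ) ^ n := by
  rw [X_eq_indicator, integral_indicator_one (h.measurableSet_success hij)]
  exact h.measureReal_setOf_mem_slots (B := fun s => net.successSet P i j (interferers s i j))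
    fun s => measurableSet_powerSigma_successSet P net hij (notMem_interferers s i j)
      (Set.subset_univ _)

theorem covariance_X [IsProbabilityMeasure Pr] (h : net.IsNakagamiALOHA Pr P S)
    {i j k l : Fin n} (hij : i ≠ j) (hkl : k ≠ l) :
    cov[net.X P S i j, net.X P S k l; Pr]
      = (∑ s : Fin n → Fin net.slots, Pr.real (net.successSet P i j (interferers s i j) ∩
          net.successSet P k l (interferers s k l))) / (net.slots : ℝ) ^ n
        - (∫ ω, net.X P S i j ω ∂Pr) * ∫ ω, net.X P S k l ω ∂Pr := by
  have hmemLp {i j : Fin n} (hij : i ≠ j) : MemLp (net.X P S i j) 2 Pr := by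
    rw [X_eq_indicator]
    exact memLp_indicator_const 2 (h.measurableSet_success hij) 1 (Or.inr (measure_ne_top _ _))
  have hB {i j : Fin n} (hij : i ≠ j) (s : Fin n → Fin net.slots) :
      MeasurableSet[powerSigma P Set.univ] (net.successSet P i j (interferers s i j)) :=
    measurableSet_powerSigma_successSet P net hij (notMem_interferers s i j) (Set.subset_univ _)
  rw [covariance_eq_sub (hmemLp hij) (hmemLp hkl)]
  congr 1
  rw [X_eq_indicator, X_eq_indicator, ← Set.inter_indicator_one,
    integral_indicator_one ((h.measurableSet_success hij).inter (h.measurableSet_success hkl))]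
  exact h.measureReal_setOf_mem_slots (B := fun s => net.successSet P i j (interferers s i j) ∩
    net.successSet P k l (interferers s k l)) fun s => (hB hij s).inter (hB hkl s)

end IsNakagamiALOHA

section MacroState

variable {m : ℕ}

/-- The class of the slot `a` relative to the slots `κ` and `κ'` of two transmitters: `1` if
`a = κ`, `2` if `a = κ' ≠ κ`, and `0` otherwise. -/
def slotClass (κ κ' a : Fin m) : ℕ :=
  if a = κ then 1 else if a = κ' then 2 else 0

/-- The macro state of the slot choice `s` seen by the transmitters `i` and `k`: every other node is
mapped to the class of its slot relative to the slots of `i` and `k`. -/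
def macroState (s : Fin n → Fin m) (i k ν : Fin n) : ℕ :=
  if ν = i ∨ ν = k then 0 else slotClass (s i) (s k) (s ν)

theorem slotClass_self (κ a : Fin m) : slotClass κ κ a = if a = κ then 1 else 0 := by
  simp +contextual [slotClass]

theorem slotClass_eq_zero_iff {κ κ' a : Fin m} : slotClass κ κ' a = 0 ↔ a ≠ κ ∧ a ≠ κ' := by
  unfold slotClass
  split_ifs <;> simp_all

theorem slotClass_eq_one_iff {κ κ' a : Fin m} : slotClass κ κ' a = 1 ↔ a = κ := by
  simp [slotClass, ite_eq_iff]

theorem slotClass_eq_two_iff {κ κ' a : Fin m} (hκ : κ ≠ κ') : slotClass κ κ' a = 2 ↔ a = κ' := by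
  by_cases ha : a = κ <;> simp [slotClass, ha, hκ]

theorem card_filter_slotClass_eq_zero (κ κ' : Fin m) :
    ((Finset.univ.filter fun a => slotClass κ κ' a = 0).card : ℝ)
      = m - (({κ, κ'} : Finset (Fin m)).card : ℝ) := by
  have hcompl : (Finset.univ.filter fun a => slotClass κ κ' a = 0) = {κ, κ'}ᶜ := by
    ext a
    rw [Finset.mem_filter_univ, slotClass_eq_zero_iff]
    simp
  rw [hcompl, Finset.card_compl, Fintype.card_fin,
    Nat.cast_sub ((Finset.card_le_univ _).trans_eq (Fintype.card_fin m))]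

theorem card_filter_slotClass_eq_one (κ κ' : Fin m) :
    (Finset.univ.filter fun a => slotClass κ κ' a = 1).card = 1 := by
  have hsingleton : (Finset.univ.filter fun a => slotClass κ κ' a = 1) = {κ} := by
    ext a
    rw [Finset.mem_filter_univ, slotClass_eq_one_iff, Finset.mem_singleton]
  rw [hsingleton, Finset.card_singleton]

theorem card_filter_slotClass_eq_two {κ κ' : Fin m} (hκ : κ ≠ κ') :
    (Finset.univ.filter fun a => slotClass κ κ' a = 2).card = 1 := by
  have hsingleton : (Finset.univ.filter fun a => slotClass κ κ' a = 2) = {κ'} := by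
    ext a
    rw [Finset.mem_filter_univ, slotClass_eq_two_iff hκ, Finset.mem_singleton]
  rw [hsingleton, Finset.card_singleton]

theorem prod_card_filter_slotClass_eq_phi (net : Network n) (J : Finset (Fin n))
    (κ : Fin net.slots) {c : Fin n → ℕ} (hc : ∀ ν, c ν < 2) :
    ∏ ν ∈ J, ((Finset.univ.filter fun a => slotClass κ κ a = c ν).card : ℝ) = net.phi J c := by
  refine Finset.prod_congr rfl fun ν _ => ?_
  have hcν := hc ν
  interval_cases c ν
  · simp [card_filter_slotClass_eq_zero]
  · simp [card_filter_slotClass_eq_one]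

theorem prod_card_filter_slotClass_eq_psi (net : Network n) (J : Finset (Fin n))
    {κ κ' : Fin net.slots} (hκ : κ ≠ κ') {c : Fin n → ℕ} (hc : ∀ ν, c ν < 3) :
    ∏ ν ∈ J, ((Finset.univ.filter fun a => slotClass κ κ' a = c ν).card : ℝ) = net.psi J c := by
  refine Finset.prod_congr rfl fun ν _ => ?_
  have hcν := hc ν
  interval_cases c ν
  · simp [card_filter_slotClass_eq_zero, Finset.card_pair hκ]
  · simp [card_filter_slotClass_eq_one]
  · simp [card_filter_slotClass_eq_two hκ]

theorem filter_slots_eq_piFinset {i k : Fin n} {κ κ' : Fin m} (hκ : i = k → κ = κ') :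
    (Finset.univ.filter fun s : Fin n → Fin m => s i = κ ∧ s k = κ')
      = Fintype.piFinset fun ν => if ν = i then {κ} else if ν = k then {κ'} else Finset.univ := by
  ext s
  simp only [Finset.mem_filter, Finset.mem_univ, true_and, Fintype.mem_piFinset]
  constructor
  · rintro ⟨rfl, rfl⟩ ν
    split_ifs <;> simp_all
  · intro hs
    have hi := hs i
    have hk := hs k
    by_cases hik : k = i <;> simp_all

theorem sum_filter_slots_eq_sum_macroStates {R : Type*} [CommSemiring R] {i k : Fin n}
    {κ κ' : Fin m} (hκ : i = k → κ = κ') {r : ℕ} (hr : ∀ a, slotClass κ κ' a < r)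
    (F : (Fin n → ℕ) → R) :
    ∑ s with s i = κ ∧ s k = κ', F (macroState s i k)
      = ∑ c ∈ macroStates (Finset.univ \ {i, k}) r, (∏ ν ∈ Finset.univ \ {i, k},
          ((Finset.univ.filter fun a => slotClass κ κ' a = c ν).card : R)) * F c := by
  have hstate : ∀ s ∈ Finset.univ.filter fun s : Fin n → Fin m => s i = κ ∧ s k = κ',
      F (macroState s i k) = F fun ν => if ν = i ∨ ν = k then 0 else slotClass κ κ' (s ν) := by
    intro s hs
    obtain ⟨rfl, rfl⟩ := (Finset.mem_filter.1 hs).2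
    rfl
  rw [Finset.sum_congr rfl hstate, filter_slots_eq_piFinset hκ, sum_piFinset_comp
    (f := fun ν a => if ν = i ∨ ν = k then 0 else slotClass κ κ' a)
    (B := fun ν => if ν ∈ Finset.univ \ {i, k} then Finset.range r else {0})]
  · refine Finset.sum_congr rfl fun c hc => congrArg (· * F c) ?_
    rw [← Finset.prod_subset (Finset.subset_univ (Finset.univ \ {i, k}))]
    · refine Finset.prod_congr rfl fun ν hν => ?_
      simp_all
    · intro ν _ hν
      have hνik : ν = i ∨ ν = k := by simpa [or_iff_not_imp_left] using hν
      have hcν : c ν = 0 := by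
        simpa only [if_neg hν, Finset.mem_singleton] using Fintype.mem_piFinset.1 hc ν
      rcases eq_or_ne ν i with hi | hi
      · simp [hi ▸ hcν, hi]
      · obtain rfl := hνik.resolve_left hi
        simp [hi, hcν]
  · intro ν a _
    by_cases hν : ν = i ∨ ν = k <;> simp [hν, hr]

theorem sum_filter_slots_eq_card_mul {R : Type*} [CommSemiring R] {i k : Fin n}
    {D : Finset (Fin m × Fin m)}
    (hD : ∀ p ∈ D, i = k → p.1 = p.2) {r : ℕ} (hr : ∀ p ∈ D, ∀ a, slotClass p.1 p.2 a < r)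
    {w : (Fin n → ℕ) → R} (hw : ∀ p ∈ D, ∀ c ∈ macroStates (Finset.univ \ {i, k}) r,
      ∏ ν ∈ Finset.univ \ {i, k},
        ((Finset.univ.filter fun a => slotClass p.1 p.2 a = c ν).card : R) = w c)
    (F : (Fin n → ℕ) → R) :
    ∑ s with (s i, s k) ∈ D, F (macroState s i k)
      = D.card * ∑ c ∈ macroStates (Finset.univ \ {i, k}) r, w c * F c := by
  have hfiber (p : Fin m × Fin m) (hp : p ∈ D) :
      ∑ s ∈ (Finset.univ.filter fun s : Fin n → Fin m => (s i, s k) ∈ D) with (s i, s k) = p,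
        F (macroState s i k) = ∑ c ∈ macroStates (Finset.univ \ {i, k}) r, w c * F c := by
    have hfilter : (Finset.univ.filter fun s : Fin n → Fin m => (s i, s k) ∈ D).filter
        (fun s => (s i, s k) = p) = Finset.univ.filter fun s => s i = p.1 ∧ s k = p.2 := by
      ext s
      simp only [Finset.mem_filter, Finset.mem_univ, true_and, Prod.ext_iff]
      exact and_iff_right_of_imp fun hs => by rwa [hs.1, hs.2]
    rw [hfilter, sum_filter_slots_eq_sum_macroStates (hD p hp) (hr p hp)]
    exact Finset.sum_congr rfl fun c hc => by rw [hw p hp c hc]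
  rw [← Finset.sum_fiberwise_of_maps_to (g := fun s : Fin n → Fin m => (s i, s k)) (t := D)
    (by simp), Finset.sum_congr rfl hfiber, Finset.sum_const, nsmul_eq_mul]

theorem sum_filter_slots_eq (net : Network n) (i k : Fin n) (F : (Fin n → ℕ) → ℝ) :
    ∑ s : Fin n → Fin net.slots with s i = s k, F (macroState s i k)
      = net.slots * ∑ c ∈ macroStates (Finset.univ \ {i, k}) 2,
          net.phi (Finset.univ \ {i, k}) c * F c := by
  have hsum := sum_filter_slots_eq_card_mul (i := i) (k := k)
    (D := (Finset.univ : Finset (Fin net.slots)).diag) (r := 2)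
    (w := net.phi (Finset.univ \ {i, k})) (by simp)
    (fun p hp a => by
      rw [← (Finset.mem_diag.1 hp).2, slotClass_self]
      split_ifs <;> norm_num)
    (fun p hp c hc => by
      rw [← (Finset.mem_diag.1 hp).2]
      exact net.prod_card_filter_slotClass_eq_phi _ p.1 (lt_of_mem_macroStates two_pos hc)) F
  simpa using hsum

theorem sum_filter_slots_ne (net : Network n) {i k : Fin n} (hik : i ≠ k)
    (F : (Fin n → ℕ) → ℝ) :
    ∑ s : Fin n → Fin net.slots with s i ≠ s k, F (macroState s i k)
      = net.slots * (net.slots - 1) * ∑ c ∈ macroStates (Finset.univ \ {i, k}) 3,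
          net.psi (Finset.univ \ {i, k}) c * F c := by
  have hsum := sum_filter_slots_eq_card_mul (i := i) (k := k)
    (D := (Finset.univ : Finset (Fin net.slots)).offDiag) (r := 3)
    (w := net.psi (Finset.univ \ {i, k})) (fun _ _ h => (hik h).elim)
    (fun p _ a => by unfold slotClass; split_ifs <;> norm_num)
    (fun p hp c hc => net.prod_card_filter_slotClass_eq_psi _ (Finset.mem_offDiag.1 hp).2.2
      (lt_of_mem_macroStates three_pos hc)) F
  simpa [Finset.offDiag_card, Nat.cast_sub (Nat.le_mul_self _), mul_sub] using hsum

theorem macroState_comm {s : Fin n → Fin m} {i k : Fin n} (hs : s i = s k) :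
    macroState s i k = macroState s k i := by
  ext ν
  simp [macroState, hs, or_comm]

end MacroState

theorem sum_macroStates_prod {R : Type*} [CommSemiring R] (K : Finset (Fin n)) (r : ℕ)
    (g : Fin n → ℕ → R) :
    ∑ c ∈ macroStates K r, ∏ ν ∈ K, g ν (c ν) = ∏ ν ∈ K, ∑ a ∈ Finset.range r, g ν a := by
  have hext (f : Fin n → R) : ∏ ν ∈ K, f ν = ∏ ν, if ν ∈ K then f ν else 1 := by
    rw [Finset.prod_ite_mem, Finset.univ_inter]
  simp_rw [hext]
  rw [macroStates, ← Finset.prod_univ_sum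
    (f := fun ν a => if ν ∈ K then g ν a else 1)]
  refine Finset.prod_congr rfl fun ν _ => ?_
  split_ifs <;> simp

theorem sum_phi_mul_prod (net : Network n) {J K : Finset (Fin n)} (hJK : J ⊆ K)
    (a b : Fin n → ℝ) :
    ∑ c ∈ macroStates K 2, net.phi K c * ∏ ν ∈ J, ((1 - (c ν : ℝ)) * a ν + c ν * b ν)
      = net.slots ^ K.card
        * ∏ ν ∈ J, ((1 - 1 / (net.slots : ℝ)) * a ν + 1 / net.slots * b ν) := by
  have hm := net.cast_slots_pos
  have hext (f : Fin n → ℝ) : ∏ ν ∈ J, f ν = ∏ ν ∈ K, if ν ∈ J then f ν else 1 := by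
    rw [Finset.prod_ite_mem, Finset.inter_eq_right.2 hJK]
  simp_rw [hext, phi, ← Finset.prod_mul_distrib]
  rw [sum_macroStates_prod K 2 fun ν l => ((net.slots : ℝ) - 1) ^ (1 - l) *
    if ν ∈ J then (1 - (l : ℝ)) * a ν + l * b ν else 1, ← Finset.prod_const,
    ← Finset.prod_mul_distrib]
  refine Finset.prod_congr rfl fun ν _ => ?_
  split_ifs
  · simp [Finset.sum_range_succ]
    field_simp
  · simp [Finset.sum_range_succ]

-- `γ_xy` is affine in each coordinate of `ξ`, so averaging it over independent Bernoulli states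
-- replaces these by their mean.
theorem sum_phi_mul_gamma (net : Network n) (x y : Fin n) {J K : Finset (Fin n)} (hJK : J ⊆ K) :
    ∑ c ∈ macroStates K 2, net.phi K c * net.gamma x y J (fun ν => (c ν : ℝ))
      = net.slots ^ K.card * net.gamma x y J fun _ => 1 / (net.slots : ℝ) := by
  have hterm (e : ℝ) (ℓ : Fin n → ℕ) :
      ∑ c ∈ macroStates K 2, net.phi K c * (e * ∏ ν ∈ J, ((1 - (c ν : ℝ)) *
        (if ℓ ν = 0 then 1 else 0) + c ν * net.tiltedMoment x y ν (ℓ ν)))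
        = net.slots ^ K.card * (e * ∏ ν ∈ J, ((1 - 1 / (net.slots : ℝ)) *
          (if ℓ ν = 0 then 1 else 0) + 1 / net.slots * net.tiltedMoment x y ν (ℓ ν))) := by
    rw [mul_left_comm, ← net.sum_phi_mul_prod hJK, Finset.mul_sum]
    simp only [mul_left_comm e]
  simp only [gamma_eq, Finset.mul_sum, ← mul_assoc (Real.exp _), ← mul_assoc (_ * _ ^ _)]
  rw [Finset.sum_comm]
  refine Finset.sum_congr rfl fun s _ => ?_
  rw [Finset.sum_comm]
  refine Finset.sum_congr rfl fun t _ => ?_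
  rw [Finset.sum_comm]
  exact Finset.sum_congr rfl fun ℓ _ => hterm _ ℓ

namespace IsNakagamiALOHA

variable {net : Network n} {Ω : Type*} [MeasurableSpace Ω] {Pr : Measure Ω}
  {P : Fin n → Fin n → Ω → ℝ} {S : Fin n → Ω → Fin net.slots}

theorem measureReal_successSet_eq_alphaClosed [IsProbabilityMeasure Pr]
    (h : net.IsNakagamiALOHA Pr P S) {x y z : Fin n}
    (hxy : x ≠ y) {s : Fin n → Fin net.slots} (hs : s z = s x) :
    Pr.real (net.successSet P x y (interferers s x y))
      = net.alphaClosed x y z (macroState s x z) := by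
  refine h.measureReal_successSet hxy (Finset.filter_subset _ _) (by simp) (by simp) fun ν hν => ?_
  have hνxy : ν ≠ x ∧ ν ≠ y := by simpa using hν
  by_cases hz : ν = z
  · simp [hz ▸ hνxy, hz, hs]
  · by_cases hslot : s ν = s x <;> simp [hz, hs, macroState, hνxy, slotClass_self, hslot]

theorem measureReal_successSet_eq_betaClosed [IsProbabilityMeasure Pr]
    (h : net.IsNakagamiALOHA Pr P S) {x y z : Fin n}
    (hxy : x ≠ y) {s : Fin n → Fin net.slots} (hs : s z ≠ s x) {d : ℕ} {c : Fin n → ℕ}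
    (hc : ∀ ν, ν ≠ x → ν ≠ z → (c ν = d ↔ s ν = s x)) :
    Pr.real (net.successSet P x y (interferers s x y)) = net.betaClosed d x y z c := by
  refine h.measureReal_successSet hxy (fun ν hν => ?_) (by simp) (by simp) fun ν hν => ?_
  · obtain ⟨⟨hx, hy⟩, hsν⟩ := mem_interferers.1 hν
    have hz : ν ≠ z := fun hz => hs (hz ▸ hsν)
    simp [hx, hy, hz]
  · obtain ⟨hx, hy, hz⟩ : ν ≠ x ∧ ν ≠ y ∧ ν ≠ z := by simpa using hν
    simp [mem_interferers, hx, hy, hc ν hx hz]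

theorem sum_filter_slots_eq_measureReal_inter [IsProbabilityMeasure Pr]
    (h : net.IsNakagamiALOHA Pr P S) {i j k l : Fin n}
    (hij : i ≠ j) (hkl : k ≠ l) (hjl : j ≠ l) :
    ∑ s : Fin n → Fin net.slots with s i = s k, Pr.real (net.successSet P i j (interferers s i j) ∩
        net.successSet P k l (interferers s k l))
      = net.slots * Phi (Finset.univ \ {i, k}) (net.phi (Finset.univ \ {i, k}))
          net.alphaClosed i j k l := by
  simp_rw [Phi, mul_assoc, ← net.sum_filter_slots_eq i k fun c =>
    net.alphaClosed i j k c * net.alphaClosed k l i c]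
  refine Finset.sum_congr rfl fun s hs => ?_
  have hik : s i = s k := (Finset.mem_filter.1 hs).2
  rw [h.measureReal_successSet_inter hij hkl (notMem_interferers s i j) (notMem_interferers s k l)
      fun hjl' => (hjl hjl').elim,
    h.measureReal_successSet_eq_alphaClosed hij hik.symm,
    h.measureReal_successSet_eq_alphaClosed hkl hik, macroState_comm hik]

theorem sum_filter_slots_eq_measureReal_inter_eq_zero (h : net.IsNakagamiALOHA Pr P S)
    {i j k : Fin n} (hij : i ≠ j) (hkj : k ≠ j) (hik : i ≠ k) :
    ∑ s : Fin n → Fin net.slots with s i = s k, Pr.real (net.successSet P i j (interferers s i j) ∩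
        net.successSet P k j (interferers s k j)) = 0 := by
  refine Finset.sum_eq_zero fun s hs => ?_
  have hs' : s i = s k := (Finset.mem_filter.1 hs).2
  exact h.measureReal_successSet_inter_eq_zero (notMem_interferers s i j) (notMem_interferers s k j)
    (mem_interferers.2 ⟨⟨hik.symm, hkj⟩, hs'.symm⟩) (mem_interferers.2 ⟨⟨hik, hij⟩, hs'⟩)

theorem sum_filter_slots_ne_measureReal_inter [IsProbabilityMeasure Pr]
    (h : net.IsNakagamiALOHA Pr P S) {i j k l : Fin n}
    (hij : i ≠ j) (hkl : k ≠ l) (hik : i ≠ k) :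
    ∑ s : Fin n → Fin net.slots with s i ≠ s k, Pr.real (net.successSet P i j (interferers s i j) ∩
        net.successSet P k l (interferers s k l))
      = net.slots * (net.slots - 1) * Psi (Finset.univ \ {i, k}) (net.psi (Finset.univ \ {i, k}))
          net.betaClosed i j k l := by
  simp_rw [Psi, mul_assoc (net.psi _ _), ← net.sum_filter_slots_ne hik fun c =>
    net.betaClosed 1 i j k c * net.betaClosed 2 k l i c]
  refine Finset.sum_congr rfl fun s hs => ?_
  have hs' : s i ≠ s k := (Finset.mem_filter.1 hs).2
  have hone (ν : Fin n) (hi : ν ≠ i) (hk : ν ≠ k) : macroState s i k ν = 1 ↔ s ν = s i := by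
    rw [macroState, if_neg (not_or.2 ⟨hi, hk⟩), slotClass_eq_one_iff]
  have htwo (ν : Fin n) (hk : ν ≠ k) (hi : ν ≠ i) : macroState s i k ν = 2 ↔ s ν = s k := by
    rw [macroState, if_neg (not_or.2 ⟨hi, hk⟩), slotClass_eq_two_iff hs']
  rw [h.measureReal_successSet_inter hij hkl (notMem_interferers s i j) (notMem_interferers s k l)
      fun _ => disjoint_insert_interferers hs' j l,
    h.measureReal_successSet_eq_betaClosed hij hs'.symm hone,
    h.measureReal_successSet_eq_betaClosed hkl hs' htwo]

theorem integral_X_eq_gamma [IsProbabilityMeasure Pr] (h : net.IsNakagamiALOHA Pr P S)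
    {i j : Fin n} (hij : i ≠ j) :
    ∫ ω, net.X P S i j ω ∂Pr
      = net.gamma i j (Finset.univ \ {i, j}) fun _ => 1 / (net.slots : ℝ) := by
  have hm := net.cast_slots_pos.ne'
  have hlink (s : Fin n → Fin net.slots) : Pr.real (net.successSet P i j (interferers s i j))
      = net.alphaSame i j (macroState s i i) := by
    rw [h.measureReal_successSet_eq_alphaClosed hij rfl, alphaClosed_self]
  have hsum := net.sum_filter_slots_eq i i (net.alphaSame i j)
  have hsub : Finset.univ \ {i, j} ⊆ Finset.univ \ {i} :=
    Finset.sdiff_subset_sdiff Finset.Subset.rfl (by simp)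
  have hcard : (Finset.univ \ {i}).card = n - 1 := by simp [Finset.card_sdiff]
  simp only [Finset.filter_true, Finset.pair_eq_singleton, alphaSame] at hsum
  rw [net.sum_phi_mul_gamma i j hsub, hcard] at hsum
  rw [h.integral_X hij]
  simp only [hlink, alphaSame]
  rw [hsum, ← mul_assoc, mul_pow_sub_one i.pos.ne', mul_div_cancel_left₀ _ (pow_ne_zero n hm)]

theorem covariance_X_same_transmitter [IsProbabilityMeasure Pr]
    (h : net.IsNakagamiALOHA Pr P S) {i j l : Fin n}
    (hij : i ≠ j) (hil : i ≠ l) (hjl : j ≠ l) :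
    cov[net.X P S i j, net.X P S i l; Pr]
      = Phi (Finset.univ \ {i}) (net.phi (Finset.univ \ {i})) (fun x y _ c => net.alphaSame x y c)
          i j i l / (net.slots : ℝ) ^ (n - 1)
        - (∫ ω, net.X P S i j ω ∂Pr) * ∫ ω, net.X P S i l ω ∂Pr := by
  have hm := net.cast_slots_pos.ne'
  have hsum := h.sum_filter_slots_eq_measureReal_inter hij hil hjl
  simp only [Finset.filter_true, Finset.pair_eq_singleton] at hsum
  rw [h.covariance_X hij hil, hsum, ← mul_pow_sub_one i.pos.ne', mul_div_mul_left _ _ hm]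
  simp only [Phi, alphaClosed_self]

theorem covariance_X_of_ne_transmitter [IsProbabilityMeasure Pr]
    (h : net.IsNakagamiALOHA Pr P S) {i j k l : Fin n}
    (hij : i ≠ j) (hkl : k ≠ l) (hik : i ≠ k) :
    cov[net.X P S i j, net.X P S k l; Pr]
      = (if l = j then 0 else 1) / (net.slots : ℝ) ^ (n - 1)
            * Phi (Finset.univ \ {i, k}) (net.phi (Finset.univ \ {i, k})) net.alphaClosed i j k l
        + ((net.slots : ℝ) - 1) / (net.slots : ℝ) ^ (n - 1)
            * Psi (Finset.univ \ {i, k}) (net.psi (Finset.univ \ {i, k})) net.betaClosed i j k l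
        - (∫ ω, net.X P S i j ω ∂Pr) * ∫ ω, net.X P S k l ω ∂Pr := by
  have hm := net.cast_slots_pos.ne'
  have heq : ∑ s : Fin n → Fin net.slots with s i = s k,
      Pr.real (net.successSet P i j (interferers s i j) ∩ net.successSet P k l (interferers s k l))
      = net.slots * ((if l = j then 0 else 1) * Phi (Finset.univ \ {i, k})
          (net.phi (Finset.univ \ {i, k})) net.alphaClosed i j k l) := by
    split_ifs with hlj
    · subst hlj
      rw [h.sum_filter_slots_eq_measureReal_inter_eq_zero hij hkl hik, zero_mul, mul_zero]
    · rw [h.sum_filter_slots_eq_measureReal_inter hij hkl (Ne.symm hlj), one_mul]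
  rw [h.covariance_X hij hkl, ← Finset.sum_filter_add_sum_filter_not _ fun s => s i = s k, heq,
    h.sum_filter_slots_ne_measureReal_inter hij hkl hik, ← mul_pow_sub_one i.pos.ne', mul_assoc,
    ← mul_add, mul_div_mul_left _ _ hm]
  ring

end IsNakagamiALOHA

end Network

theorem corollary2 {n : ℕ} (hn : 3 ≤ n) (net : Network n)
    {Ω : Type*} [MeasurableSpace Ω] (Pr : Measure Ω) [IsProbabilityMeasure Pr]
    (P : Fin n → Fin n → Ω → ℝ) (S : Fin n → Ω → Fin net.slots)
    (hmodel : net.IsNakagamiALOHA Pr P S) :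
    -- expectations
    (∀ i j : Fin n, i ≠ j →
      ∫ ω, net.X P S i j ω ∂Pr
        = net.gamma i j (Finset.univ \ {i, j}) fun _ => 1 / (net.slots : ℝ)) ∧
    -- state coefficients
    (∀ x y : Fin n, x ≠ y → ∀ c ∈ Network.macroStates (Finset.univ \ {x}) 2,
      net.alpha Pr P x y x c = net.alphaSame x y c) ∧
    (∀ x y z : Fin n, x ≠ y → x ≠ z → ∀ c ∈ Network.macroStates (Finset.univ \ {x, z}) 2,
      net.alpha Pr P x y z c = net.alphaClosed x y z c) ∧
    (∀ x y z : Fin n, x ≠ y → x ≠ z → ∀ d ∈ ({1, 2} : Finset ℕ),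
      ∀ c ∈ Network.macroStates (Finset.univ \ {x, z}) 3,
        net.beta Pr P d x y z c = net.betaClosed d x y z c) ∧
    -- covariances of two links with the same transmitter
    (∀ i j l : Fin n, i ≠ j → i ≠ l → j ≠ l →
      cov[net.X P S i j, net.X P S i l; Pr]
        = Network.Phi (Finset.univ \ {i}) (net.phi (Finset.univ \ {i}))
            (fun x y _ c => net.alphaSame x y c) i j i l / (net.slots : ℝ) ^ (n - 1)
          - (∫ ω, net.X P S i j ω ∂Pr) * ∫ ω, net.X P S i l ω ∂Pr) ∧
    -- covariances of two links with different transmitters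
    (∀ i j k l : Fin n, i ≠ j → k ≠ l → i ≠ k →
      cov[net.X P S i j, net.X P S k l; Pr]
        = (if l = j then 0 else 1) / (net.slots : ℝ) ^ (n - 1)
            * Network.Phi (Finset.univ \ {i, k}) (net.phi (Finset.univ \ {i, k}))
                net.alphaClosed i j k l
          + ((net.slots : ℝ) - 1) / (net.slots : ℝ) ^ (n - 1)
            * Network.Psi (Finset.univ \ {i, k}) (net.psi (Finset.univ \ {i, k}))
                net.betaClosed i j k l
          - (∫ ω, net.X P S i j ω ∂Pr) * ∫ ω, net.X P S k l ω ∂Pr) := by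
  refine ⟨fun i j hij => hmodel.integral_X_eq_gamma hij, fun x y hxy c hc => ?_,
    fun x y z hxy _ c hc => ?_, fun x y z hxy _ d _ c _ => hmodel.beta_eq_betaClosed hxy d z c,
    fun i j l hij hil hjl => hmodel.covariance_X_same_transmitter hij hil hjl,
    fun i j k l hij hkl hik => hmodel.covariance_X_of_ne_transmitter hij hkl hik⟩
  · rw [← net.alphaClosed_self]
    exact hmodel.alpha_eq_alphaClosed hxy x (Network.lt_of_mem_macroStates two_pos hc)
  · exact hmodel.alpha_eq_alphaClosed hxy z (Network.lt_of_mem_macroStates two_pos hc)
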